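/- A regular cell complex structure on a Hausdorff space $X$ is a finite collection of closed balls in $X$ (the closed cells; each is the homeomorphic image of a closed Euclidean unit ball of some dimension $\ge 0$), such that the interiors of these balls (the open cells) partition $X$ and the boundary sphere of each ball is a union of closed cells. For $x\in X$ let $\sigma(x)$ be the unique open cell containing $x$. The star of an open cell $\sigma$ is $$\operatorname{st}(\sigma)=\{y\in X : y \text{ lies in some open cell whose closure contains } \sigma\}.$$ A space $S$ strongly deformation retracts onto a subspace $A\subseteq S$ if there is a homotopy $H:S\times[0,1]\to S$ with $H(s,0)=s$ and $H(s,1)\in A$ for all $s\in S$, and $H(a,t)=a$ for all $a\in A$ and $t\in[0,1]$. **Lemma 3.1.** Let $X$ be a regular cell complex and let $\sigma$ be an open cell of $X$. Then $\operatorname{st}(\sigma)$ strongly deformation retracts onto $\sigma$, and $\operatorname{st}(\sigma)$ is contractible. Moreover, for every point $x\in\sigma$, the space $X\setminus\{x\}$ strongly deformation retracts onto $X\setminus\operatorname{st}(\sigma(x))$. -/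

import Mathlib

open Set Metric

universe u v

/-- A (finite) regular cell complex structure on a Hausdorff space `X`: a finite family of closed
balls in `X` (the closed cells, of arbitrary dimensions `≥ 0`) whose interiors (the open cells)
partition `X`, and such that the boundary sphere of each ball is a union of closed cells.
A ball in `X` is given by a parametrization by the closed Euclidean unit ball, which is continuous
and injective there, hence an embedding since `X` is Hausdorff and the ball is compact.  There are
finitely many compact cells, so `X` carries the weak topology automatically. -/
structure RegularCellComplex (X : Type u) [TopologicalSpace X] where
  /-- The index type of the cells. -/
  Cell : Type v
  finite_cell : Finite Cell
  /-- The dimension of a cell. -/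
  dim : Cell → ℕ
  /-- The characteristic map of a cell; only its values on the closed unit ball matter. -/
  map (e : Cell) : EuclideanSpace ℝ (Fin (dim e)) → X
  continuousOn (e : Cell) : ContinuousOn (map e) (closedBall 0 1)
  injOn (e : Cell) : InjOn (map e) (closedBall 0 1)
  /-- The open cells partition `X`: they are disjoint and they cover `X`. -/
  existsUnique_mem (x : X) : ∃! e : Cell, x ∈ map e '' ball 0 1
  /-- The boundary of each cell is a union of closed cells. -/
  boundary (e : Cell) : ∃ S : Set Cell, map e '' sphere 0 1 = ⋃ e' ∈ S, map e' '' closedBall 0 1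

namespace RegularCellComplex

/-- The open cell with index `e`. -/
def openCell {X : Type*} [TopologicalSpace X] (K : RegularCellComplex X) (e : K.Cell) : Set X :=
  K.map e '' ball 0 1

/-- The (index of the) unique open cell `σ(x)` containing the point `x`. -/
noncomputable def cellAt {X : Type*} [TopologicalSpace X] (K : RegularCellComplex X) (x : X) :
    K.Cell :=
  (K.existsUnique_mem x).choose

/-- The open star `st(σ)`: the points lying in some open cell whose closure contains `σ`. -/
def star {X : Type*} [TopologicalSpace X] (K : RegularCellComplex X) (σ : K.Cell) : Set X :=
  {y | ∃ τ : K.Cell, y ∈ K.openCell τ ∧ K.openCell σ ⊆ closure (K.openCell τ)}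

end RegularCellComplex

/-- The subspace `S` of `X` strongly deformation retracts onto its subset `A`: there is a homotopy
of maps `S → S`, from the identity to a map with values in `A`, fixing `A` pointwise at all
times. -/
def StrongDeformationRetractsOnto {X : Type*} [TopologicalSpace X] (S A : Set X) : Prop :=
  A ⊆ S ∧ ∃ r : C(S, S), (∀ s : S, (r s : X) ∈ A) ∧
    (ContinuousMap.id S).HomotopicRel r {s : S | (s : X) ∈ A}

/-! Order the cells by the face relation: stars become up-sets and closed subcomplexes down-sets.
Both deformations strip off maximal cells one at a time, moving a single open cell into its boundary
and fixing everything else (`glue`). For the punctured space, each cell above `σ(x)` is emptied by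
radial projection from `x` (`closedBall_diff_singleton`), which also works when `x` lies on the
boundary of that cell. For the star, the part `U` of it in the boundary of the top cell is
contractible by induction, and an open ball together with a contractible, relatively open `U` in its
sphere deforms onto `U` (`ball_union`). Contracting the ball `σ` afterwards makes the star
contractible. -/

/-- A set-level form of `StrongDeformationRetractsOnto`: the homotopy is a globally defined map,
controlled only on `S × [0, 1]`. -/
def DeformsOnto {X : Type*} [TopologicalSpace X] (S A : Set X) : Prop :=
  A ⊆ S ∧ ∃ H : X × ℝ → X, ContinuousOn H (S ×ˢ Icc 0 1) ∧ MapsTo H (S ×ˢ Icc 0 1) S ∧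
    (∀ s ∈ S, H (s, 0) = s) ∧ (∀ s ∈ S, H (s, 1) ∈ A) ∧ ∀ a ∈ A, ∀ t ∈ Icc (0 : ℝ) 1, H (a, t) = a

/-! ### Composing, gluing and transporting deformations -/

theorem continuousOn_of_isClosed_cover {X Y : Type*} [TopologicalSpace X] [TopologicalSpace Y]
    {f : X → Y} {S F G : Set X} (hF : IsClosed F) (hG : IsClosed G) (hS : S ⊆ F ∪ G)
    (hf : ContinuousOn f (S ∩ F)) (hg : ContinuousOn f (S ∩ G)) : ContinuousOn f S := by
  have key : ∀ C : Set X, IsClosed C → ContinuousOn f (S ∩ C) → ∀ x ∈ S,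
      ContinuousWithinAt f (S ∩ C) x := by
    intro C hC h x hx
    by_cases hxC : x ∈ C
    · exact h x ⟨hx, hxC⟩
    -- Away from the closed set `C` the condition is vacuous.
    · refine continuousWithinAt_of_notMem_closure fun hcl => hxC ?_
      exact hC.closure_subset (closure_mono inter_subset_right hcl)
  intro x hx
  refine ((key F hF hf x hx).union (key G hG hg x hx)).mono ?_
  rw [← inter_union_distrib_left]
  exact fun y hy => ⟨hy, hS hy⟩

namespace DeformsOnto

section Topology

variable {X Y : Type*} [TopologicalSpace X] [TopologicalSpace Y] {S A B : Set X}

theorem refl (S : Set X) : DeformsOnto S S :=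
  ⟨Subset.rfl, Prod.fst, continuousOn_fst, fun _ hp => hp.1, fun _ _ => rfl, fun _ h => h,
    fun _ _ _ _ => rfl⟩

theorem trans (h : DeformsOnto S A) (h' : DeformsOnto A B) : DeformsOnto S B := by
  obtain ⟨hAS, H, Hc, Hm, H0, H1, HA⟩ := h
  obtain ⟨hBA, G, Gc, Gm, G0, G1, GB⟩ := h'
  classical
  refine ⟨hBA.trans hAS, fun p => if p.2 ≤ 1 / 2 then H (p.1, 2 * p.2) else
    G (H (p.1, 1), 2 * p.2 - 1), ?_, ?_, ?_, ?_, ?_⟩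
  · refine continuousOn_of_isClosed_cover (F := {p | p.2 ≤ 1 / 2}) (G := {p | 1 / 2 ≤ p.2})
      (isClosed_le continuous_snd continuous_const) (isClosed_le continuous_const continuous_snd)
      (fun p _ => le_total p.2 (1 / 2)) ?_ ?_
    · refine ContinuousOn.congr (f := fun p => H (p.1, 2 * p.2)) ?_ fun p hp =>
        if_pos (show p.2 ≤ 1 / 2 from hp.2)
      refine Hc.comp (by fun_prop) ?_
      rintro ⟨x, t⟩ ⟨⟨hx, ht⟩, h2⟩
      simp only [mem_ofPred_eq, mem_Icc, mem_prod] at *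
      exact ⟨hx, by linarith, by linarith⟩
    · refine ContinuousOn.congr (f := fun p => G (H (p.1, 1), 2 * p.2 - 1)) ?_ ?_
      · refine Gc.comp (ContinuousOn.prodMk (Hc.comp (by fun_prop) ?_) (by fun_prop)) ?_
        · rintro ⟨x, t⟩ ⟨⟨hx, ht⟩, h2⟩
          exact ⟨hx, by simp⟩
        · rintro ⟨x, t⟩ ⟨⟨hx, ht⟩, h2⟩
          simp only [mem_ofPred_eq, mem_Icc, mem_prod] at *
          exact ⟨H1 x hx, by linarith, by linarith⟩
      · rintro ⟨x, t⟩ ⟨⟨hx, ht⟩, h2⟩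
        simp only [mem_ofPred_eq] at hx h2 ⊢
        split_ifs with h3
        · obtain rfl : t = 1 / 2 := le_antisymm h3 h2
          norm_num
          exact (G0 _ (H1 x hx)).symm
        · rfl
  · rintro ⟨x, t⟩ ⟨hx, ht⟩
    simp only [mem_Icc] at hx ht ⊢
    split_ifs with h3
    · exact Hm ⟨hx, by constructor <;> dsimp <;> linarith⟩
    · exact hAS (Gm ⟨H1 x hx, by constructor <;> dsimp <;> linarith⟩)
  · intro s hs
    simp [H0 s hs]
  · intro s hs
    norm_num
    exact G1 _ (H1 s hs)
  · intro a ha t ht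
    simp only [mem_Icc] at ht ⊢
    split_ifs with h3
    · exact HA a (hBA ha) _ ⟨by linarith, by linarith⟩
    · rw [HA a (hBA ha) 1 (by simp)]
      exact GB a ha _ ⟨by linarith, by linarith⟩

/-- A deformation of `S ∩ G` is stationary on the overlap with `F`, so it extends by the identity.
-/
theorem glue {F G : Set X} (hF : IsClosed F) (hG : IsClosed G) (hS : S ⊆ F ∪ G)
    (h : DeformsOnto (S ∩ G) (S ∩ F ∩ G)) : DeformsOnto S (S ∩ F) := by
  obtain ⟨-, H, Hc, Hm, H0, H1, HA⟩ := h
  classical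
  refine ⟨inter_subset_left, fun p => if p.1 ∈ G then H p else p.1, ?_, ?_, ?_, ?_, ?_⟩
  · refine continuousOn_of_isClosed_cover (hF.preimage continuous_fst)
      (hG.preimage continuous_fst) (fun p hp => hS hp.1) ?_ ?_
    · refine continuousOn_fst.congr ?_
      rintro ⟨x, t⟩ ⟨⟨hx, ht⟩, hxF⟩
      dsimp only
      split_ifs with hxG
      · exact HA x ⟨⟨hx, hxF⟩, hxG⟩ t ht
      · rfl
    · refine (Hc.mono ?_).congr fun p hp => if_pos hp.2
      rintro ⟨x, t⟩ ⟨⟨hx, ht⟩, hxG⟩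
      exact ⟨⟨hx, hxG⟩, ht⟩
  · rintro ⟨x, t⟩ ⟨hx, ht⟩
    dsimp only
    split_ifs with hxG
    · exact (Hm ⟨⟨hx, hxG⟩, ht⟩).1
    · exact hx
  · intro s hs
    dsimp only
    split_ifs with hsG
    · exact H0 s ⟨hs, hsG⟩
    · rfl
  · intro s hs
    dsimp only
    split_ifs with hsG
    · exact (H1 s ⟨hs, hsG⟩).1
    · exact ⟨hs, (hS hs).resolve_right hsG⟩
  · intro a ha t ht
    dsimp only
    split_ifs with haG
    · exact HA a ⟨ha, haG⟩ t ht
    · rfl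

theorem image {φ : X → Y} {ψ : Y → X} (hφ : ContinuousOn φ S) (hψ : ContinuousOn ψ (φ '' S))
    (hl : LeftInvOn ψ φ S) (h : DeformsOnto S A) : DeformsOnto (φ '' S) (φ '' A) := by
  obtain ⟨hAS, H, Hc, Hm, H0, H1, HA⟩ := h
  have hψm : MapsTo ψ (φ '' S) S := by
    rintro _ ⟨x, hx, rfl⟩
    rwa [hl hx]
  refine ⟨image_mono hAS, fun p => φ (H (ψ p.1, p.2)), ?_, ?_, ?_, ?_, ?_⟩
  · refine hφ.comp (Hc.comp (ContinuousOn.prodMk (hψ.comp continuousOn_fst fun p hp => hp.1)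
      continuousOn_snd) fun p hp => ⟨hψm hp.1, hp.2⟩) fun p hp => Hm ⟨hψm hp.1, hp.2⟩
  · exact fun p hp => mem_image_of_mem φ (Hm ⟨hψm hp.1, hp.2⟩)
  · rintro _ ⟨x, hx, rfl⟩
    simp only [hl hx, H0 x hx]
  · rintro _ ⟨x, hx, rfl⟩
    simp only [hl hx]
    exact mem_image_of_mem φ (H1 x hx)
  · rintro _ ⟨x, hx, rfl⟩ t ht
    simp only [hl (hAS hx), HA x hx t ht]

theorem strongDeformationRetractsOnto (h : DeformsOnto S A) :
    StrongDeformationRetractsOnto S A := by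
  obtain ⟨hAS, H, Hc, Hm, H0, H1, HA⟩ := h
  have hcont : Continuous fun p : unitInterval × S =>
      (⟨H (p.2, p.1), Hm ⟨p.2.2, p.1.2⟩⟩ : S) :=
    (Hc.comp_continuous (by fun_prop) fun p => ⟨p.2.2, p.1.2⟩).subtype_mk _
  refine ⟨hAS, ⟨fun s => ⟨H (s, 1), Hm ⟨s.2, by simp⟩⟩,
    (Hc.comp_continuous (by fun_prop) fun s => ⟨s.2, by simp⟩).subtype_mk _⟩,
    fun s => H1 s s.2, ⟨⟨⟨⟨_, hcont⟩, ?_, ?_⟩, ?_⟩⟩⟩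
  · exact fun s => Subtype.ext (H0 s s.2)
  · exact fun s => rfl
  · exact fun t s hs => Subtype.ext (HA s hs t t.2)

theorem contractibleSpace {p : X} (h : DeformsOnto S {p}) : ContractibleSpace S := by
  obtain ⟨hp, r, hr, hom⟩ := h.strongDeformationRetractsOnto
  rw [contractible_iff_id_nullhomotopic]
  refine ⟨⟨p, hp rfl⟩, ?_⟩
  have : r = ContinuousMap.const S ⟨p, hp rfl⟩ := by
    ext s
    exact hr s
  rw [← this]
  exact hom.homotopic

end Topology

/-! ### Explicit deformations of Euclidean balls -/

section Ball

variable {E : Type*} [NormedAddCommGroup E] [InnerProductSpace ℝ E]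

/-- A set contracts linearly onto a subset if it retracts onto it and contains the segments joining
its points to their images. -/
theorem of_retraction {S A : Set E} (hAS : A ⊆ S) {r : E → E} (hr : ContinuousOn r S)
    (hrS : MapsTo r S A) (hrA : ∀ a ∈ A, r a = a) (hseg : ∀ s ∈ S, segment ℝ s (r s) ⊆ S) :
    DeformsOnto S A := by
  refine ⟨hAS, fun p => AffineMap.lineMap p.1 (r p.1) p.2, ?_, ?_, ?_, ?_, ?_⟩
  · have : ContinuousOn (fun p : E × ℝ => r p.1) (S ×ˢ Icc 0 1) :=
      hr.comp continuousOn_fst fun p hp => hp.1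
    simp only [AffineMap.lineMap_apply_module]
    exact ((continuousOn_const.sub continuousOn_snd).smul continuousOn_fst).add
      (continuousOn_snd.smul this)
  · rintro ⟨x, t⟩ ⟨hx, ht⟩
    refine hseg x hx ?_
    rw [segment_eq_image_lineMap]
    exact mem_image_of_mem _ ht
  · intro s _
    simp
  · intro s hs
    simpa using hrS hs
  · intro a ha t _
    simp [hrA a ha]

theorem ball_center : DeformsOnto (ball (0 : E) 1) {0} :=
  of_retraction (r := fun _ => 0) (by simp) continuousOn_const (fun _ _ => rfl) (by simp)
    fun _ hs => (convex_ball _ _).segment_subset hs (by simp)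

/-- The closed ball without one of its points is pushed away from that point onto the sphere. -/
theorem closedBall_diff_singleton {x : E} (hx : x ∈ closedBall (0 : E) 1) :
    DeformsOnto (closedBall (0 : E) 1 \ {x}) (sphere 0 1 \ {x}) := by
  set a : E → ℝ := fun y => inner ℝ (y - x) (y - x) with ha
  set b : E → ℝ := fun y => inner ℝ x (y - x) with hb
  set c : ℝ := 1 - inner ℝ x x with hc
  -- The larger root of `a s² + 2 b s = c`, which says that `x + s (y - x)` has norm one.
  set s : E → ℝ := fun y => (-b y + √(b y ^ 2 + a y * c)) / a y with hs
  have ha0 : ∀ y, y ≠ x → 0 < a y := fun y hy => real_inner_self_pos.2 (sub_ne_zero.2 hy)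
  have hc0 : 0 ≤ c := by
    rw [mem_closedBall_zero_iff] at hx
    simp only [hc, real_inner_self_eq_norm_sq]
    nlinarith [norm_nonneg x]
  have hnorm : ∀ y (t : ℝ), ‖x + t • (y - x)‖ ^ 2 = a y * t ^ 2 + 2 * b y * t + (1 - c) := by
    intro y t
    simp only [ha, hb, hc]
    rw [← real_inner_self_eq_norm_sq, inner_add_add_self, real_inner_smul_left,
      real_inner_smul_right, real_inner_smul_left, real_inner_smul_right,
      real_inner_comm x (y - x)]
    ring
  have hroot : ∀ y, y ≠ x → ‖x + s y • (y - x)‖ = 1 := by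
    intro y hy
    have h1 : ‖x + s y • (y - x)‖ ^ 2 = 1 := by
      rw [hnorm]
      have h2 : √(b y ^ 2 + a y * c) ^ 2 = b y ^ 2 + a y * c :=
        Real.sq_sqrt (by have := ha0 y hy; positivity)
      have h3 : a y * s y = -b y + √(b y ^ 2 + a y * c) := by
        simp only [hs]
        field_simp [(ha0 y hy).ne']
      have h4 : (a y * s y + b y) ^ 2 = b y ^ 2 + a y * c := by
        rw [h3, neg_add_eq_sub, sub_add_cancel, h2]
      have h5 : a y * (a y * s y ^ 2 + 2 * b y * s y - c) = 0 := by linarith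
      have := (mul_eq_zero.1 h5).resolve_left (ha0 y hy).ne'
      linarith
    exact (pow_eq_one_iff_of_nonneg (norm_nonneg _) two_ne_zero).1 h1
  have hnorm1 : ∀ y, ‖y‖ ^ 2 = a y + 2 * b y + (1 - c) := by
    intro y
    simpa using hnorm y 1
  have hs1 : ∀ y ∈ closedBall (0 : E) 1 \ {x}, 1 ≤ s y := by
    rintro y ⟨hy, hyx⟩
    have := ha0 y hyx
    rw [mem_closedBall_zero_iff] at hy
    have hy2 : ‖y‖ ^ 2 ≤ 1 := by nlinarith [norm_nonneg y]
    rw [hnorm1] at hy2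
    simp only [hs]
    rw [le_div_iff₀ this, one_mul]
    -- After squaring, this is `a + 2b ≤ c`, that is, `‖y‖ ≤ 1`.
    have : a y + b y ≤ √(b y ^ 2 + a y * c) := Real.le_sqrt_of_sq_le (by nlinarith)
    linarith
  refine of_retraction (r := fun y => x + s y • (y - x)) (sdiff_subset_sdiff_left
    sphere_subset_closedBall) ?_ ?_ ?_ ?_
  · have : ContinuousOn s (closedBall (0 : E) 1 \ {x}) := by
      refine ContinuousOn.div (by fun_prop) (by fun_prop) fun y hy => (ha0 y hy.2).ne'
    fun_prop
  · intro y hy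
    refine ⟨mem_sphere_zero_iff_norm.2 (hroot y hy.2), fun h => ?_⟩
    simp only [mem_singleton_iff, add_eq_left, smul_eq_zero] at h
    rcases h with h | h
    · linarith [hs1 y hy]
    · exact hy.2 (sub_eq_zero.1 h)
  · rintro y ⟨hy, hyx⟩
    suffices s y = 1 by simp [this]
    rw [mem_sphere_zero_iff_norm] at hy
    have h1 := hnorm1 y
    rw [hy] at h1
    have h2 : b y ^ 2 + a y * c = (a y + b y) ^ 2 := by
      have : c = a y + 2 * b y := by linarith
      rw [this]
      ring
    have h3 : 0 ≤ a y + b y := by linarith [ha0 y hyx]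
    simp only [hs]
    rw [h2, Real.sqrt_sq h3]
    field_simp [(ha0 y hyx).ne']
    ring
  · intro y hy z hz
    refine ⟨(convex_closedBall _ _).segment_subset hy.1
      (sphere_subset_closedBall (mem_sphere_zero_iff_norm.2 (hroot y hy.2))) hz, ?_⟩
    rw [segment_eq_image_lineMap] at hz
    obtain ⟨t, ht, rfl⟩ := hz
    -- The segment runs away from `x`: the coefficient of `y - x` stays at least one.
    have h1 : AffineMap.lineMap y (x + s y • (y - x)) t = x + (1 + t * (s y - 1)) • (y - x) := by
      rw [AffineMap.lineMap_apply_module]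
      module
    rw [h1]
    intro h
    simp only [mem_singleton_iff, add_eq_left, smul_eq_zero] at h
    rcases h with h | h
    · nlinarith [hs1 y hy, ht.1]
    · exact hy.2 (sub_eq_zero.1 h)

/-- The open ball together with a contractible relatively open part `U` of its boundary sphere
deforms onto `U`. -/
theorem ball_union {U : Set E} (hU : U ⊆ sphere 0 1) (hcl : IsClosed (sphere 0 1 \ U)) {p : E}
    (h : DeformsOnto U {p}) : DeformsOnto (ball 0 1 ∪ U) U := by
  obtain ⟨hp, H, Hc, Hm, H0, H1, -⟩ := h
  replace hp : p ∈ U := hp rfl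
  set G : Set E := insert 0 (sphere 0 1 \ U) with hG
  have hGc : IsClosed G := (isClosed_singleton (x := (0 : E))).union hcl
  set g : E → ℝ := fun y => infDist y G with hg
  have hgc : Continuous g := continuous_infDist_pt G
  have hnorm : ∀ y ∈ ball (0 : E) 1 ∪ U, ‖y‖ ≤ 1 := by
    rintro y (hy | hy)
    · exact (mem_ball_zero_iff.1 hy).le
    · exact (mem_sphere_zero_iff_norm.1 (hU hy)).le
  have hgy : ∀ y, g y ≤ ‖y‖ := fun y => by
    simpa using infDist_le_dist_of_mem (x := y) (mem_insert 0 (sphere 0 1 \ U))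
  have hgU : ∀ y ∈ U, 0 < g y := by
    intro y hy
    refine (hGc.notMem_iff_infDist_pos ⟨0, mem_insert _ _⟩).1 ?_
    rintro (rfl | h)
    · simpa using hU hy
    · exact h.2 hy
  -- A collar of `U` in which `H` can be run. A point of `R` whose radial projection missed `U`
  -- would satisfy `g y ≤ 1 - ‖y‖`, and the factor 2 then forces `‖y‖ = 1`. Since `0 ∈ G` gives `g y
  -- ≤ ‖y‖`, the origin is not in `R`.
  set R : Set E := {y | 2 * (1 - ‖y‖) ≤ g y} with hR
  have hR0 : ∀ y ∈ ball (0 : E) 1 ∪ U, y ∈ R → 0 < ‖y‖ := by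
    intro y hy hyR
    have h1 := hgy y
    have h2 : 2 * (1 - ‖y‖) ≤ g y := hyR
    linarith
  have hRg : ∀ y ∈ ball (0 : E) 1 ∪ U, y ∈ R → 0 < g y := by
    rintro y (hy | hy) hyR
    · have h2 : 2 * (1 - ‖y‖) ≤ g y := hyR
      linarith [mem_ball_zero_iff.1 hy]
    · exact hgU y hy
  have hRU : ∀ y ∈ ball (0 : E) 1 ∪ U, y ∈ R → ‖y‖⁻¹ • y ∈ U := by
    intro y hy hyR
    have h0 := hR0 y hy hyR
    have hu : ‖y‖⁻¹ • y ∈ sphere (0 : E) 1 := by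
      rw [mem_sphere_zero_iff_norm, norm_smul, norm_inv, norm_norm, inv_mul_cancel₀ h0.ne']
    by_contra hnot
    have h1 : g y ≤ dist y (‖y‖⁻¹ • y) := infDist_le_dist_of_mem (Or.inr ⟨hu, hnot⟩)
    have h2 : dist y (‖y‖⁻¹ • y) = 1 - ‖y‖ := by
      have : ‖y‖⁻¹ • y - y = (‖y‖⁻¹ - 1) • y := by module
      rw [dist_comm, dist_eq_norm, this, norm_smul, Real.norm_of_nonneg, sub_mul,
        inv_mul_cancel₀ h0.ne', one_mul]
      have := (one_le_inv₀ h0).2 (hnorm y hy)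
      linarith
    have h3 : 2 * (1 - ‖y‖) ≤ g y := hyR
    have h4 : ‖y‖ = 1 := le_antisymm (hnorm y hy) (by linarith)
    rw [h4] at hnot
    rcases hy with hy | hy
    · linarith [mem_ball_zero_iff.1 hy]
    · exact hnot (by simpa using hy)
  have hRI : ∀ y ∈ ball (0 : E) 1 ∪ U, y ∈ R → 2 * (1 - ‖y‖) / g y ∈ Icc (0 : ℝ) 1 := by
    intro y hy hyR
    have h1 := hRg y hy hyR
    have h2 := hnorm y hy
    exact ⟨div_nonneg (by linarith) h1.le, (div_le_one h1).2 hyR⟩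
  classical
  -- The time is 0 on `U` and 1 on the inner edge of the collar, where `H` takes the value `p` and
  -- matches the constant outside.
  set r : E → E := fun y => if y ∈ R then H (‖y‖⁻¹ • y, 2 * (1 - ‖y‖) / g y) else p with hr
  have hrU : MapsTo r (ball 0 1 ∪ U) U := by
    intro y hy
    simp only [hr]
    split_ifs with hyR
    · exact Hm ⟨hRU y hy hyR, hRI y hy hyR⟩
    · exact hp
  refine of_retraction (r := r) subset_union_right ?_ hrU ?_ ?_
  · refine continuousOn_of_isClosed_cover (F := R) (G := {y | g y ≤ 2 * (1 - ‖y‖)})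
      (isClosed_le (by fun_prop) hgc) (isClosed_le hgc (by fun_prop))
      (fun y _ => le_total (2 * (1 - ‖y‖)) (g y)) ?_ ?_
    · refine ContinuousOn.congr ?_ fun y hy => if_pos hy.2
      refine Hc.comp (ContinuousOn.prodMk ?_ ?_) fun y hy => ⟨hRU y hy.1 hy.2, hRI y hy.1 hy.2⟩
      · exact (continuous_norm.continuousOn.inv₀ fun y hy => (hR0 y hy.1 hy.2).ne').smul
          continuousOn_id
      · exact ContinuousOn.div (by fun_prop) hgc.continuousOn
          fun y hy => (hRg y hy.1 hy.2).ne'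
    · refine continuousOn_const (c := p) |>.congr fun y hy => ?_
      simp only [hr]
      split_ifs with hyR
      · have h1 : 2 * (1 - ‖y‖) = g y := le_antisymm hyR hy.2
        rw [h1, div_self (hRg y hy.1 hyR).ne']
        exact H1 _ (hRU y hy.1 hyR)
      · rfl
  · intro y hy
    have h1 : ‖y‖ = 1 := mem_sphere_zero_iff_norm.1 (hU hy)
    have h2 : y ∈ R := by
      simp only [hR, mem_ofPred_eq, h1, sub_self, mul_zero]
      exact (hgU y hy).le
    simp only [hr, if_pos h2, h1, inv_one, one_smul, sub_self, mul_zero, zero_div]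
    exact H0 y hy
  · intro y hy
    -- By strict convexity only the endpoints of the segment can touch the sphere, and both lie in
    -- the set.
    rw [← insert_endpoints_openSegment]
    refine insert_subset hy (insert_subset (Or.inr (hrU hy)) ?_)
    by_cases hyr : y = r y
    · rw [← hyr, openSegment_same]
      exact singleton_subset_iff.2 hy
    · have h1 := (strictConvex_closedBall ℝ (0 : E) 1).openSegment_subset
        (mem_closedBall_zero_iff.2 (hnorm y hy))
        (mem_closedBall_zero_iff.2 (hnorm _ (Or.inr (hrU hy)))) hyr
      rw [interior_closedBall _ one_ne_zero] at h1
      exact h1.trans subset_union_left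

end Ball

end DeformsOnto

/-- Preimages of closed sets under the inverse are images of compact sets, hence closed. -/
theorem ContinuousOn.invFunOn_of_isCompact {X Y : Type*} [TopologicalSpace X] [TopologicalSpace Y]
    [T2Space Y] [Nonempty X] {f : X → Y} {s : Set X} (hs : IsCompact s) (hf : ContinuousOn f s)
    (hinj : InjOn f s) : ContinuousOn (Function.invFunOn f s) (f '' s) := by
  rw [continuousOn_iff_isClosed]
  intro t ht
  refine ⟨f '' (s ∩ t), ((hs.inter_right ht).image_of_continuousOn
    (hf.mono inter_subset_left)).isClosed, ?_⟩
  ext y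
  constructor
  · rintro ⟨hy, x, hx, rfl⟩
    rw [mem_preimage, hinj.leftInvOn_invFunOn hx] at hy
    exact ⟨⟨x, ⟨hx, hy⟩, rfl⟩, x, hx, rfl⟩
  · rintro ⟨⟨x, ⟨hx, hxt⟩, rfl⟩, h⟩
    refine ⟨?_, h⟩
    rwa [mem_preimage, hinj.leftInvOn_invFunOn hx]

/-! ### The face order and its topology -/

namespace RegularCellComplex

variable {X : Type u} [TopologicalSpace X] (K : RegularCellComplex.{u, v} X)

/-- The closed cell with index `e`. -/
def closedCell (e : K.Cell) : Set X :=
  K.map e '' closedBall 0 1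

theorem mem_openCell_cellAt (x : X) : x ∈ K.openCell (K.cellAt x) :=
  (K.existsUnique_mem x).choose_spec.1

variable {K}

theorem mem_openCell_iff {x : X} {e : K.Cell} : x ∈ K.openCell e ↔ K.cellAt x = e := by
  refine ⟨fun h => ((K.existsUnique_mem x).choose_spec.2 e h).symm, ?_⟩
  rintro rfl
  exact K.mem_openCell_cellAt x

variable (K)

theorem openCell_nonempty (e : K.Cell) : (K.openCell e).Nonempty :=
  ⟨_, mem_image_of_mem _ (mem_ball_self one_pos)⟩

theorem openCell_subset_closedCell (e : K.Cell) : K.openCell e ⊆ K.closedCell e :=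
  image_mono ball_subset_closedBall

theorem map_image_sphere (e : K.Cell) :
    K.map e '' sphere 0 1 = K.closedCell e \ K.openCell e := by
  rw [closedCell, openCell, ← (K.injOn e).image_sdiff_subset ball_subset_closedBall,
    closedBall_sdiff_ball]

theorem isCompact_closedCell (e : K.Cell) : IsCompact (K.closedCell e) :=
  (isCompact_closedBall _ _).image_of_continuousOn (K.continuousOn e)

theorem closedCell_subset_of_mem_boundary {e f : K.Cell} {S : Set K.Cell}
    (hS : K.map f '' sphere 0 1 = ⋃ e' ∈ S, K.map e' '' closedBall 0 1) (he : e ∈ S) :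
    K.closedCell e ⊆ K.closedCell f \ K.openCell f := by
  rw [← K.map_image_sphere, hS]
  exact subset_biUnion_of_mem (u := fun e' => K.map e' '' closedBall 0 1) he

/-- A boundary point of `f` lies in a closed cell within that boundary. This cell misses the open
cell `f`, so it is strictly smaller, and induction on inclusion applies. -/
theorem openCell_subset_closedCell_of_mem {x : X} {f : K.Cell} (hx : x ∈ K.closedCell f) :
    K.openCell (K.cellAt x) ⊆ K.closedCell f := by
  have := K.finite_cell
  have wf : WellFounded fun e f : K.Cell => K.closedCell e ⊂ K.closedCell f :=
    haveI : IsTrans K.Cell fun e f => K.closedCell e ⊂ K.closedCell f :=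
      ⟨fun _ _ _ => lt_trans⟩
    haveI : Std.Irrefl fun e f : K.Cell => K.closedCell e ⊂ K.closedCell f :=
      ⟨fun _ => ssubset_irrefl _⟩
    Finite.wellFounded_of_trans_of_irrefl _
  induction f using wf.induction with
  | _ f ih =>
    by_cases h : x ∈ K.openCell f
    · rw [mem_openCell_iff.1 h]
      exact K.openCell_subset_closedCell f
    · obtain ⟨S, hS⟩ := K.boundary f
      have hx' : x ∈ K.map f '' sphere 0 1 := by
        rw [K.map_image_sphere]
        exact ⟨hx, h⟩
      rw [hS] at hx'
      obtain ⟨e, he, hxe⟩ := mem_iUnion₂.1 hx'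
      have hsub := K.closedCell_subset_of_mem_boundary hS he
      refine (ih e ⟨hsub.trans sdiff_subset, fun hfe => ?_⟩ hxe).trans (hsub.trans sdiff_subset)
      obtain ⟨y, hy⟩ := K.openCell_nonempty f
      exact (hsub (hfe (K.openCell_subset_closedCell f hy))).2 hy

theorem openCell_eq_preimage (e : K.Cell) : K.openCell e = K.cellAt ⁻¹' {e} :=
  ext fun _ => mem_openCell_iff

/-- The inverse of the characteristic map of a cell. -/
noncomputable def coord (e : K.Cell) : X → EuclideanSpace ℝ (Fin (K.dim e)) :=
  Function.invFunOn (K.map e) (closedBall 0 1)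

theorem leftInvOn_coord (e : K.Cell) : LeftInvOn (K.coord e) (K.map e) (closedBall 0 1) :=
  (K.injOn e).leftInvOn_invFunOn

theorem rightInvOn_coord (e : K.Cell) : LeftInvOn (K.map e) (K.coord e) (K.closedCell e) := by
  rintro _ ⟨y, hy, rfl⟩
  rw [K.leftInvOn_coord e hy]

variable [T2Space X]

theorem isClosed_closedCell (e : K.Cell) : IsClosed (K.closedCell e) :=
  (K.isCompact_closedCell e).isClosed

theorem closure_openCell (e : K.Cell) : closure (K.openCell e) = K.closedCell e := by
  refine (closure_minimal (K.openCell_subset_closedCell e) (K.isClosed_closedCell e)).antisymm ?_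
  have h := (K.continuousOn e).mono (closure_ball (0 : EuclideanSpace ℝ (Fin (K.dim e)))
    one_ne_zero).subset
  have := h.image_closure
  rwa [closure_ball _ one_ne_zero] at this

/-- The face order on the cells. -/
instance : PartialOrder K.Cell where
  le e f := K.openCell e ⊆ K.closedCell f
  le_refl := K.openCell_subset_closedCell
  le_trans e f g h h' := by
    refine h.trans ?_
    rw [← K.closure_openCell]
    exact closure_minimal h' (K.isClosed_closedCell g)
  le_antisymm e f h h' := by
    -- Distinct open cells are disjoint, so `e` would lie in the boundary of `f`, which is closed
    -- and would contain the closure of `e`, hence `f` itself.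
    by_contra hne
    have hb : K.openCell e ⊆ K.map f '' sphere 0 1 := by
      rw [K.map_image_sphere]
      intro x hx
      exact ⟨h hx, fun hxf => hne ((mem_openCell_iff.1 hx).symm.trans (mem_openCell_iff.1 hxf))⟩
    have hcl : IsClosed (K.map f '' sphere 0 1) :=
      ((isCompact_sphere _ _).image_of_continuousOn
        ((K.continuousOn f).mono sphere_subset_closedBall)).isClosed
    obtain ⟨x, hx⟩ := K.openCell_nonempty f
    have := closure_minimal hb hcl (K.closure_openCell e ▸ h' hx)
    rw [K.map_image_sphere] at this
    exact this.2 hx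

/-- From here on, set identities between unions of cells reduce to identities in the face order. -/
theorem closedCell_eq_preimage (e : K.Cell) : K.closedCell e = K.cellAt ⁻¹' Iic e :=
  ext fun x => ⟨fun hx => K.openCell_subset_closedCell_of_mem hx,
    fun hx => hx (K.mem_openCell_cellAt x)⟩

theorem map_image_sphere_eq_preimage (e : K.Cell) :
    K.map e '' sphere 0 1 = K.cellAt ⁻¹' Iio e := by
  rw [K.map_image_sphere, closedCell_eq_preimage, openCell_eq_preimage, ← preimage_sdiff,
    Iic_sdiff_right]

theorem star_eq_preimage (σ : K.Cell) : K.star σ = K.cellAt ⁻¹' Ici σ := by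
  ext y
  simp only [star, K.closure_openCell, mem_openCell_iff, mem_ofPred_eq]
  exact ⟨by rintro ⟨τ, rfl, h⟩; exact h, fun h => ⟨_, rfl, h⟩⟩

theorem isClosed_preimage_of_isLowerSet {T : Set K.Cell} (hT : IsLowerSet T) :
    IsClosed (K.cellAt ⁻¹' T) := by
  have := K.finite_cell
  have : K.cellAt ⁻¹' T = ⋃ e ∈ T, K.closedCell e := by
    ext x
    simp only [closedCell_eq_preimage, mem_preimage, mem_iUnion, mem_Iic, exists_prop]
    exact ⟨fun h => ⟨_, h, le_rfl⟩, fun ⟨e, he, h⟩ => hT h he⟩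
  rw [this]
  exact T.toFinite.isClosed_biUnion fun e _ => K.isClosed_closedCell e

/-! ### Deformations inside one closed cell -/

theorem continuousOn_coord (e : K.Cell) : ContinuousOn (K.coord e) (K.closedCell e) :=
  ContinuousOn.invFunOn_of_isCompact (isCompact_closedBall _ _) (K.continuousOn e) (K.injOn e)

theorem deformsOnto_image {e : K.Cell} {S A : Set (EuclideanSpace ℝ (Fin (K.dim e)))}
    (hS : S ⊆ closedBall 0 1) (h : DeformsOnto S A) :
    DeformsOnto (K.map e '' S) (K.map e '' A) :=
  h.image ((K.continuousOn e).mono hS) ((K.continuousOn_coord e).mono (image_mono hS))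
    ((K.leftInvOn_coord e).mono hS)

theorem openCell_deformsOnto (e : K.Cell) : DeformsOnto (K.openCell e) {K.map e 0} := by
  simpa only [image_singleton, openCell] using
    K.deformsOnto_image ball_subset_closedBall DeformsOnto.ball_center

theorem closedCell_diff_singleton_deformsOnto {e : K.Cell} {x : X} (hx : x ∈ K.closedCell e) :
    DeformsOnto (K.closedCell e \ {x}) (K.cellAt ⁻¹' Iio e \ {x}) := by
  obtain ⟨y, hy, rfl⟩ := hx
  have h := K.deformsOnto_image sdiff_subset (DeformsOnto.closedBall_diff_singleton hy)
  have himg : ∀ S ⊆ closedBall 0 1, K.map e '' (S \ {y}) = (K.map e '' S) \ {K.map e y} := by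
    intro S hS
    ext z
    constructor
    · rintro ⟨w, ⟨hw, hne⟩, rfl⟩
      exact ⟨⟨w, hw, rfl⟩, fun h => hne (K.injOn e (hS hw) hy h)⟩
    · rintro ⟨⟨w, hw, rfl⟩, hne⟩
      exact ⟨w, ⟨hw, fun h => hne (congrArg _ h)⟩, rfl⟩
  rwa [himg _ Subset.rfl, himg _ sphere_subset_closedBall, map_image_sphere_eq_preimage] at h

/-- If the part of the star of `σ` in the boundary of `τ` contracts, then the part of the star in the
closed cell `τ` deforms onto it. -/
theorem preimage_Icc_deformsOnto {σ τ : K.Cell} (hστ : σ < τ) {p : X}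
    (h : DeformsOnto (K.cellAt ⁻¹' Ico σ τ) {p}) :
    DeformsOnto (K.cellAt ⁻¹' Icc σ τ) (K.cellAt ⁻¹' Ico σ τ) := by
  have hsph := K.map_image_sphere_eq_preimage τ
  have hclosed := K.closedCell_eq_preimage τ
  have hcoord : K.coord τ '' (K.cellAt ⁻¹' Iio τ) = sphere 0 1 := by
    rw [← hsph]
    exact ((K.leftInvOn_coord τ).mono sphere_subset_closedBall).image_image
  have hsub : K.cellAt ⁻¹' Ico σ τ ⊆ K.closedCell τ := by
    rw [hclosed]
    exact preimage_mono fun e he => he.2.le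
  set U := K.coord τ '' (K.cellAt ⁻¹' Ico σ τ) with hU
  have hUs : U ⊆ sphere 0 1 := by
    rw [← hcoord]
    exact image_mono (preimage_mono fun e he => he.2)
  have hmapU : K.map τ '' U = K.cellAt ⁻¹' Ico σ τ := ((K.rightInvOn_coord τ).mono hsub).image_image
  -- The complement consists of the proper faces of `τ` not above `σ`; they form a lower set, so
  -- their union is compact.
  have hcl : IsClosed (sphere 0 1 \ U) := by
    have hlow : IsLowerSet (Iio τ \ Ici σ) := fun a b hba ha =>
      ⟨hba.trans_lt ha.1, fun hb => ha.2 (le_trans hb hba)⟩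
    have hsub' : K.cellAt ⁻¹' (Iio τ \ Ici σ) ⊆ K.closedCell τ := by
      rw [hclosed]
      exact preimage_mono fun e he => (le_of_lt he.1 : e ≤ τ)
    have hinj : InjOn (K.coord τ) (K.cellAt ⁻¹' Iio τ) :=
      (K.rightInvOn_coord τ).injOn.mono (by
        rw [hclosed]
        exact preimage_mono Iio_subset_Iic_self)
    have heq : sphere 0 1 \ U = K.coord τ '' (K.cellAt ⁻¹' (Iio τ \ Ici σ)) := by
      rw [← hcoord, hU, ← hinj.image_sdiff_subset (preimage_mono fun e he => he.2), ← preimage_sdiff]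
      congr 2
      ext e
      simp only [mem_sdiff, mem_Iio, mem_Ico, mem_Ici]
      tauto
    rw [heq]
    refine (IsCompact.image_of_continuousOn ?_ ((K.continuousOn_coord τ).mono hsub')).isClosed
    exact (K.isCompact_closedCell τ).of_isClosed_subset
      (K.isClosed_preimage_of_isLowerSet hlow) hsub'
  have hdef : DeformsOnto U {K.coord τ p} := by
    have := h.image (ψ := K.map τ) ((K.continuousOn_coord τ).mono hsub)
      ((K.continuousOn τ).mono (hUs.trans sphere_subset_closedBall))
      ((K.rightInvOn_coord τ).mono hsub)
    rwa [image_singleton] at this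
  have := K.deformsOnto_image (union_subset ball_subset_closedBall
    (hUs.trans sphere_subset_closedBall)) (DeformsOnto.ball_union hUs hcl hdef)
  rw [image_union, hmapU] at this
  have heq : K.map τ '' ball 0 1 ∪ K.cellAt ⁻¹' Ico σ τ = K.cellAt ⁻¹' Icc σ τ := by
    change K.openCell τ ∪ _ = _
    rw [K.openCell_eq_preimage, ← preimage_union, ← Ico_union_right hστ.le, union_comm]
  rwa [heq] at this

/-! ### Stripping off maximal cells -/

theorem isLowerSet_diff_singleton {T : Set K.Cell} (hT : IsLowerSet T) {τ : K.Cell}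
    (hmax : ∀ e ∈ T, τ ≤ e → e = τ) : IsLowerSet (T \ {τ}) := by
  rintro a b hba ⟨ha, hne⟩
  refine ⟨hT hba ha, ?_⟩
  rintro rfl
  exact hne (hmax a ha hba)

/-- Quantifying over all lower sets lets induction serve twice: on `Iio τ`, to contract the star
within the boundary of a maximal cell `τ`, and on `T \ {τ}`, to continue once `τ` is removed. -/
theorem star_inter_deformsOnto (σ : K.Cell) (T : Set K.Cell) (hT : IsLowerSet T) (hσ : σ ∈ T) :
    DeformsOnto (K.cellAt ⁻¹' (T ∩ Ici σ)) (K.openCell σ) := by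
  have := K.finite_cell
  induction T using WellFoundedLT.induction with
  | _ T ih =>
    rcases (T ∩ Ioi σ).eq_empty_or_nonempty with hemp | hne
    · have : T ∩ Ici σ = {σ} := by
        ext e
        refine ⟨fun ⟨h, h'⟩ => ?_, ?_⟩
        · by_contra hes
          exact hemp.subset ⟨h, lt_of_le_of_ne h' (Ne.symm hes)⟩
        · rintro rfl
          exact ⟨hσ, self_mem_Ici⟩
      rw [this, openCell_eq_preimage]
      exact DeformsOnto.refl _
    · obtain ⟨τ, ⟨hτT, hστ⟩, hmax⟩ := (toFinite (T ∩ Ioi σ)).exists_maximal hne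
      have hστ' : σ < τ := hστ
      have hmax' : ∀ e ∈ T, τ ≤ e → e = τ := fun e he hle =>
        le_antisymm (hmax ⟨he, hστ'.trans_le hle⟩ hle) hle
      have hlow := K.isLowerSet_diff_singleton hT hmax'
      have h1 : DeformsOnto (K.cellAt ⁻¹' Ico σ τ) (K.openCell σ) := by
        have := ih (Iio τ) ⟨fun e he => hT (le_of_lt he) hτT, fun h => lt_irrefl τ (h hτT)⟩
          (isLowerSet_Iio τ) hστ
        rwa [inter_comm, Ici_inter_Iio] at this
      have h2 := K.preimage_Icc_deformsOnto hστ' (h1.trans (K.openCell_deformsOnto σ))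
      have h3 : DeformsOnto (K.cellAt ⁻¹' (T ∩ Ici σ)) (K.cellAt ⁻¹' (T ∩ Ici σ) ∩
          K.cellAt ⁻¹' (T \ {τ})) := by
        refine DeformsOnto.glue (G := K.cellAt ⁻¹' Iic τ) (K.isClosed_preimage_of_isLowerSet hlow)
          (K.isClosed_preimage_of_isLowerSet (isLowerSet_Iic τ)) ?_ ?_
        · rintro x ⟨hx, -⟩
          by_cases hxτ : K.cellAt x = τ
          · exact Or.inr hxτ.le
          · exact Or.inl ⟨hx, hxτ⟩
        · convert h2 using 1
          · ext x
            simp only [mem_inter_iff, mem_preimage, mem_Ici, mem_Iic, mem_Icc]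
            exact ⟨fun h => ⟨h.1.2, h.2⟩, fun h => ⟨⟨hT h.2 hτT, h.1⟩, h.2⟩⟩
          · ext x
            simp only [mem_inter_iff, mem_preimage, mem_Ici, mem_Iic, mem_Ico, mem_sdiff,
              mem_singleton_iff, lt_iff_le_and_ne]
            exact ⟨fun h => ⟨h.1.1.2, h.2, h.1.2.2⟩,
              fun h => ⟨⟨⟨hT h.2.1 hτT, h.1⟩, hT h.2.1 hτT, h.2.2⟩, h.2.1⟩⟩
      refine h3.trans ?_
      convert ih (T \ {τ}) ⟨sdiff_subset, fun h => (h hτT).2 rfl⟩ hlow ⟨hσ, hστ'.ne⟩ using 1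
      rw [← preimage_inter]
      congr 1
      ext e
      simp only [mem_inter_iff, mem_sdiff]
      tauto

theorem preimage_diff_singleton_deformsOnto (x : X) (T : Set K.Cell) (hT : IsLowerSet T)
    (hsub : (Ici (K.cellAt x))ᶜ ⊆ T) :
    DeformsOnto (K.cellAt ⁻¹' T \ {x}) (K.cellAt ⁻¹' (Ici (K.cellAt x))ᶜ) := by
  have := K.finite_cell
  induction T using WellFoundedLT.induction with
  | _ T ih =>
    rcases (T ∩ Ici (K.cellAt x)).eq_empty_or_nonempty with hemp | hne
    · have hTeq : T = (Ici (K.cellAt x))ᶜ :=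
        Subset.antisymm (fun e he h => hemp.subset ⟨he, h⟩) hsub
      -- The cell of `x` has already been removed, so deleting `x` changes nothing.
      have : K.cellAt ⁻¹' T \ {x} = K.cellAt ⁻¹' T := by
        refine sdiff_singleton_eq_self fun hx => ?_
        rw [hTeq] at hx
        exact hx self_mem_Ici
      rw [this, hTeq]
      exact DeformsOnto.refl _
    · obtain ⟨τ, ⟨hτT, hστ⟩, hmax⟩ := (toFinite (T ∩ Ici (K.cellAt x))).exists_maximal hne
      have hστ' : K.cellAt x ≤ τ := hστ
      have hmax' : ∀ e ∈ T, τ ≤ e → e = τ := fun e he hle =>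
        le_antisymm (hmax ⟨he, hστ'.trans hle⟩ hle) hle
      have hlow := K.isLowerSet_diff_singleton hT hmax'
      -- Every cell stripped off has `x` in its closure, so it can be emptied by projecting from
      -- `x`.
      have hxτ : x ∈ K.closedCell τ := by
        rw [closedCell_eq_preimage]
        exact hστ
      have h2 := K.closedCell_diff_singleton_deformsOnto hxτ
      rw [closedCell_eq_preimage] at h2
      have h3 : DeformsOnto (K.cellAt ⁻¹' T \ {x}) ((K.cellAt ⁻¹' T \ {x}) ∩
          K.cellAt ⁻¹' (T \ {τ})) := by
        refine DeformsOnto.glue (G := K.cellAt ⁻¹' Iic τ) (K.isClosed_preimage_of_isLowerSet hlow)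
          (K.isClosed_preimage_of_isLowerSet (isLowerSet_Iic τ)) ?_ ?_
        · rintro y ⟨hy, -⟩
          by_cases hyτ : K.cellAt y = τ
          · exact Or.inr hyτ.le
          · exact Or.inl ⟨hy, hyτ⟩
        · convert h2 using 1
          · ext y
            simp only [mem_inter_iff, mem_preimage, mem_Iic, mem_sdiff, mem_singleton_iff]
            exact ⟨fun h => ⟨h.2, h.1.2⟩, fun h => ⟨⟨hT h.1 hτT, h.2⟩, h.1⟩⟩
          · ext y
            simp only [mem_inter_iff, mem_preimage, mem_Iic, mem_Iio, mem_sdiff,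
              mem_singleton_iff, lt_iff_le_and_ne]
            exact ⟨fun h => ⟨⟨h.2, h.1.2.2⟩, h.1.1.2⟩,
              fun h => ⟨⟨⟨hT h.1.1 hτT, h.2⟩, hT h.1.1 hτT, h.1.2⟩, h.1.1⟩⟩
      refine h3.trans ?_
      convert ih (T \ {τ}) ⟨sdiff_subset, fun h => (h hτT).2 rfl⟩ hlow
        (fun e he => ⟨hsub he, fun h => he (h ▸ hστ)⟩) using 1
      ext y
      simp only [mem_inter_iff, mem_preimage, mem_sdiff]
      tauto

theorem star_deformsOnto (σ : K.Cell) : DeformsOnto (K.star σ) (K.openCell σ) := by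
  have := K.star_inter_deformsOnto σ univ isLowerSet_univ (mem_univ σ)
  rwa [univ_inter, ← star_eq_preimage] at this

theorem compl_singleton_deformsOnto (x : X) :
    DeformsOnto ({x}ᶜ : Set X) (K.star (K.cellAt x))ᶜ := by
  have := K.preimage_diff_singleton_deformsOnto x univ isLowerSet_univ (subset_univ _)
  rwa [preimage_univ, ← compl_eq_univ_sdiff, preimage_compl, ← star_eq_preimage] at this

end RegularCellComplex

theorem lemma3p1 {X : Type u} [TopologicalSpace X] [T2Space X]
    (K : RegularCellComplex.{u, v} X) (σ : K.Cell) :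
    StrongDeformationRetractsOnto (K.star σ) (K.openCell σ) ∧
    ContractibleSpace (K.star σ) ∧
    ∀ x ∈ K.openCell σ, StrongDeformationRetractsOnto ({x}ᶜ : Set X) (K.star (K.cellAt x))ᶜ :=
  ⟨(K.star_deformsOnto σ).strongDeformationRetractsOnto,
    ((K.star_deformsOnto σ).trans (K.openCell_deformsOnto σ)).contractibleSpace,
    fun x _ => (K.compl_singleton_deformsOnto x).strongDeformationRetractsOnto⟩
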